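/- A point process on $\mathbb{Z}^d$ is a probability measure $\mu$ on $\{0,1\}^{\mathbb{Z}^d}$, the space of configurations $\eta$ with $\eta(x)=1$ if the site $x$ is occupied and $\eta(x)=0$ if it is empty; write $\langle\cdot\rangle$ for expectation with respect to $\mu$. Its first two correlation functions are $\rho_1(x)=\langle\eta(x)\rangle$ and $\rho_2(x,y)=\langle\eta(x)\eta(y)\rangle-\rho_1(x)\delta_{x,y}$. For $\rho\ge 0$ and $g:\mathbb{Z}^d\to\mathbb{R}$, the pair $(\rho,g)$ is called realizable if there is a translation invariant point process on $\mathbb{Z}^d$ with $\rho_1(x)=\rho$ and $\rho_2(x,y)=\rho^2 g(y-x)$ for all $x,y\in\mathbb{Z}^d$. Theorem. Let $g$ be an even non-negative function on $\mathbb{Z}^d$ with $g(0)=0$, and suppose that $C(g):=\sum_{x\in\mathbb{Z}^d}|g(x)-1|<\infty$. Let $b$ be a constant with $1\le b<\infty$ such that, for all $n\ge 1$, $\prod_{i=1}^n g(x_i)\le b$ whenever $x_1,\dots,x_n\in\mathbb{Z}^d$ satisfy $\prod_{1\le i<j\le n} g(x_i-x_j)>0$. Then $(\rho,g)$ is realizable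 for all $\rho$ satisfying $0\le\rho\le (e\,b\,C(g))^{-1}$. -/

import Mathlib

open MeasureTheory

noncomputable section

/-- A configuration of a lattice gas on the site set `X`: every site is either
occupied (`true`) or empty (`false`). -/
abbrev LatticeConfig (X : Type*) := X → Bool

/-- The empirical field `η(x)`, equal to `1` if the site `x` is occupied and to `0` otherwise. -/
def empiricalField {X : Type*} (η : LatticeConfig X) (x : X) : ℝ :=
  if η x = true then 1 else 0

/-- The one-particle correlation function `ρ₁(x) = ⟨η(x)⟩`. -/
def corr₁ {X : Type*} (μ : Measure (LatticeConfig X)) (x : X) : ℝ :=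
  ∫ η, empiricalField η x ∂μ

open Classical in
/-- The two-particle correlation function
`ρ₂(x, y) = ⟨η(x) η(y)⟩ - ρ₁(x) δ_{x,y}`, with `δ` the Kronecker delta. -/
def corr₂ {X : Type*} (μ : Measure (LatticeConfig X)) (x y : X) : ℝ :=
  (∫ η, empiricalField η x * empiricalField η y ∂μ) - corr₁ μ x * (if x = y then 1 else 0)

/-- A law of configurations on an additive group of sites is translation invariant. -/
def IsTranslationInvariant {X : Type*} [AddGroup X] (μ : Measure (LatticeConfig X)) : Prop :=
  ∀ a : X, MeasurePreserving (fun (η : LatticeConfig X) (x : X) => η (x + a)) μ μ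

/-- `(ρ, g)` is realizable on the additive group `X`: there is a translation invariant point
process on `X` (a probability measure on configurations) whose first two correlation functions
are `ρ₁(x) = ρ` and `ρ₂(x, y) = ρ² g(y - x)`, for all sites `x, y`. -/
def IsRealizable {X : Type*} [AddGroup X] (ρ : ℝ) (g : X → ℝ) : Prop :=
  ∃ μ : Measure (LatticeConfig X), IsProbabilityMeasure μ ∧ IsTranslationInvariant μ ∧
    (∀ x, corr₁ μ x = ρ) ∧ (∀ x y, corr₂ μ x y = ρ ^ 2 * g (y - x))

/-- `b` is a stability constant for `g`: `∏ᵢ g(xᵢ) ≤ b` for all `n ≥ 1` and all `x₁, …, xₙ`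
with `∏_{i<j} g(xᵢ - xⱼ) > 0`. -/
def IsStabilityConstant {X : Type*} [AddGroup X] (g : X → ℝ) (b : ℝ) : Prop :=
  ∀ (n : ℕ), 1 ≤ n → ∀ x : Fin n → X,
    0 < ∏ i, ∏ j ∈ Finset.Ioi i, g (x i - x j) → ∏ i, g (x i) ≤ b

/-- `C(g) = ∑ₓ |g(x) - 1|` (used together with summability). -/
def absDeviation {X : Type*} (g : X → ℝ) : ℝ := ∑' x, |g x - 1|

end

/-! The candidate process has all correlations in product form: sites of `A` are jointly occupied
with probability `c A = ρ^|A| ∏ g(x - y)` over pairs in `A`. Only positivity is at stake: the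
inclusion-exclusion sums `P(A, Λ)` (`A` occupied, `Λ` empty) must be non-negative.

`inclExcl_nonneg` proves this by induction on `|Λ|`, jointly with a Kirkwood–Salsburg type bound:
given `A` occupied and `Λ` empty, a further site is occupied with probability at most `θ/(1+θ)`.
Inserting `x` into `A` gives a factor `ρ ∏ g(x - y) ≤ ρ b` and changes the weight `-1` of each `y ∈
Λ` to `-g(x - y)`. By `abs_weightedSum_le` these changes cost at most `∏ (1 + θ|g(x - y) - 1|)`.
With `θ = 1/C(g)`, the hypothesis `ρ ≤ 1/(e b C(g))` closes the induction (`insertion_bound`).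
Compactness of `{0,1}^X` then yields the measure from its finite-volume versions. -/

/-! ### Inclusion-exclusion sums and perturbation of their weights. -/

section AlternatingSum

variable {X : Type*} [DecidableEq X]

/-- The sum `∑_{B ⊆ Λ} ∏_{y ∈ B} h y * c (A ∪ B)`. -/
def weightedSum (c : Finset X → ℝ) (h : X → ℝ) (A Λ : Finset X) : ℝ :=
  ∑ B ∈ Λ.powerset, (∏ y ∈ B, h y) * c (A ∪ B)

/-- The inclusion-exclusion sum `∑_{B ⊆ Λ} (-1)^|B| c (A ∪ B)`: the probability that all sites
of `A` are occupied and all sites of `Λ` are empty, if `c A` is the probability that all sites of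
`A` are occupied. -/
def inclExcl (c : Finset X → ℝ) (A Λ : Finset X) : ℝ :=
  weightedSum c (fun _ => -1) A Λ

variable {c : Finset X → ℝ}

@[simp] lemma weightedSum_empty (h : X → ℝ) (A : Finset X) : weightedSum c h A ∅ = c A := by
  simp [weightedSum]

@[simp] lemma inclExcl_empty (A : Finset X) : inclExcl c A ∅ = c A := weightedSum_empty _ _

lemma weightedSum_insert (h : X → ℝ) (A : Finset X) {Λ : Finset X} {y : X} (hy : y ∉ Λ) :
    weightedSum c h A (insert y Λ) =
      weightedSum c h A Λ + h y * weightedSum c h (insert y A) Λ := by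
  unfold weightedSum
  rw [Finset.sum_powerset_insert hy, Finset.mul_sum]
  congr 1
  refine Finset.sum_congr rfl fun B hB => ?_
  rw [Finset.prod_insert (fun hyB => hy (Finset.mem_powerset.1 hB hyB)), Finset.union_insert,
    Finset.insert_union, mul_assoc]

lemma inclExcl_insert (A : Finset X) {Λ : Finset X} {y : X} (hy : y ∉ Λ) :
    inclExcl c A (insert y Λ) = inclExcl c A Λ - inclExcl c (insert y A) Λ := by
  unfold inclExcl
  rw [weightedSum_insert _ _ hy]
  ring

lemma weightedSum_congr {h h' : X → ℝ} (A : Finset X) {Λ : Finset X}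
    (hh : ∀ y ∈ Λ, h y = h' y) : weightedSum c h A Λ = weightedSum c h' A Λ := by
  unfold weightedSum
  refine Finset.sum_congr rfl fun B hB => ?_
  rw [Finset.prod_congr rfl fun y hy => hh y (Finset.mem_powerset.1 hB hy)]

/-- Law of total probability: the event that `A` is occupied splits according to the exact occupied
set `B` in `Λ`. -/
lemma sum_inclExcl_sdiff (A Λ : Finset X) :
    ∑ B ∈ Λ.powerset, inclExcl c (A ∪ B) (Λ \ B) = c A := by
  induction Λ using Finset.induction_on with
  | empty => simp
  | insert y Λ hy ih =>
    rw [Finset.sum_powerset_insert hy, ← Finset.sum_add_distrib]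
    refine (Finset.sum_congr rfl fun B hB => ?_).trans ih
    have hyB : y ∉ B := fun h => hy (Finset.mem_powerset.1 hB h)
    rw [Finset.insert_sdiff_of_notMem _ hyB, inclExcl_insert _ (by simp [hy]),
      Finset.insert_sdiff_insert, Finset.sdiff_insert_of_notMem hy, Finset.union_insert]
    ring

variable {θ : ℝ} {f : X → ℝ}

/-- Changing the activities one site at a time costs a factor `1 + θ |f y|` for each site. -/
lemma abs_weightedSum_le (hθ : 0 ≤ θ) (n : ℕ)
    (h_nonneg : ∀ A Λ : Finset X, Λ.card ≤ n → Disjoint A Λ → 0 ≤ inclExcl c A Λ)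
    (h_ratio : ∀ (A Λ : Finset X) (x : X), Λ.card < n → Disjoint A Λ → x ∉ A → x ∉ Λ →
      (1 + θ) * inclExcl c (insert x A) Λ ≤ θ * inclExcl c A Λ)
    (D : Finset X) : ∀ A Λ : Finset X, Λ.card ≤ n → Disjoint A Λ → D ⊆ Λ →
      |weightedSum c (fun y => if y ∈ D then -(1 + f y) else -1) A Λ| ≤
        inclExcl c A Λ * ∏ y ∈ D, (1 + θ * |f y|) := by
  induction D using Finset.induction_on with
  | empty =>
    intro A Λ hn hA _
    simpa [inclExcl] using (abs_of_nonneg (h_nonneg A Λ hn hA)).le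
  | insert y D hy ih =>
    intro A Λ hn hA hD
    obtain ⟨Λ, hyΛ, rfl⟩ : ∃ Λ', y ∉ Λ' ∧ insert y Λ' = Λ :=
      ⟨Λ.erase y, Finset.notMem_erase _ _, Finset.insert_erase (hD (Finset.mem_insert_self _ _))⟩
    rw [Finset.card_insert_of_notMem hyΛ] at hn
    obtain ⟨hyA, hA'⟩ := Finset.disjoint_insert_right.1 hA
    have hDΛ : D ⊆ Λ := fun z hz => by
      rcases Finset.mem_insert.1 (hD (Finset.mem_insert_of_mem hz)) with rfl | h
      · exact absurd hz hy
      · exact h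
    have hcongr : ∀ A', weightedSum c (fun z => if z ∈ insert y D then -(1 + f z) else -1) A' Λ =
        weightedSum c (fun z => if z ∈ D then -(1 + f z) else -1) A' Λ := fun A' =>
      weightedSum_congr A' fun z hz => by
        have : z ≠ y := fun h => hyΛ (h ▸ hz)
        simp [this]
    have hA'' : Disjoint (insert y A) Λ := Finset.disjoint_insert_left.2 ⟨hyΛ, hA'⟩
    have h1 := ih A (insert y Λ) (by rw [Finset.card_insert_of_notMem hyΛ]; exact hn) hA
      (hDΛ.trans (Finset.subset_insert _ _))
    have h2 := ih (insert y A) Λ (by omega) hA'' hDΛ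
    have h3 := h_ratio A Λ y (by omega) hA' hyA hyΛ
    -- The ratio bound in odds form compares `y` occupied with `y` empty; hence the cost `θ|f y|`.
    have h4 : inclExcl c (insert y A) Λ ≤ θ * inclExcl c A (insert y Λ) := by
      rw [inclExcl_insert _ hyΛ]; linarith
    have hprod : 0 ≤ ∏ z ∈ D, (1 + θ * |f z|) := Finset.prod_nonneg fun z _ => by positivity
    have key : weightedSum c (fun z => if z ∈ insert y D then -(1 + f z) else -1) A (insert y Λ) =
        weightedSum c (fun z => if z ∈ D then -(1 + f z) else -1) A (insert y Λ) -
          f y * weightedSum c (fun z => if z ∈ D then -(1 + f z) else -1) (insert y A) Λ := by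
      rw [weightedSum_insert _ _ hyΛ, weightedSum_insert _ _ hyΛ, hcongr, hcongr]
      simp only [Finset.mem_insert_self, if_true, if_neg hy]
      ring
    rw [key, Finset.prod_insert hy]
    refine (abs_sub _ _).trans ?_
    rw [abs_mul]
    have h5 : |f y| * |weightedSum c (fun z => if z ∈ D then -(1 + f z) else -1) (insert y A) Λ| ≤
        |f y| * (θ * inclExcl c A (insert y Λ) * ∏ z ∈ D, (1 + θ * |f z|)) :=
      mul_le_mul_of_nonneg_left (h2.trans (mul_le_mul_of_nonneg_right h4 hprod)) (abs_nonneg _)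
    linarith

end AlternatingSum

/-! ### Positivity by induction on the number of empty sites. -/

section Positivity

variable {X : Type*} [DecidableEq X] {c : Finset X → ℝ} {r : X → Finset X → ℝ}
  {f : X → X → ℝ} {ρ κ θ : ℝ}

/-- Covers the degenerate case `c A = 0`, in which the insertion bound by `κ` is not available. -/
lemma apply_union_eq_zero (hc : ∀ (A : Finset X) (x : X), x ∉ A →
      c (insert x A) = ρ * (∏ y ∈ A, (1 + f x y)) * c A)
    {A : Finset X} (hA : c A = 0) (B : Finset X) : c (A ∪ B) = 0 := by
  induction B using Finset.induction_on with
  | empty => simpa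
  | insert y B _ ih =>
    rw [Finset.union_insert]
    by_cases hy : y ∈ A ∪ B
    · rwa [Finset.insert_eq_of_mem hy]
    · rw [hc _ _ hy, ih, mul_zero]

lemma inclExcl_insert_left (hc : ∀ (A : Finset X) (x : X), x ∉ A →
      c (insert x A) = ρ * (∏ y ∈ A, (1 + f x y)) * c A)
    {A Λ : Finset X} {x : X} (hA : Disjoint A Λ) (hxA : x ∉ A) (hxΛ : x ∉ Λ) :
    inclExcl c (insert x A) Λ =
      ρ * (∏ y ∈ A, (1 + f x y)) * weightedSum c (fun y => -(1 + f x y)) A Λ := by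
  unfold inclExcl weightedSum
  rw [Finset.mul_sum]
  refine Finset.sum_congr rfl fun B hB => ?_
  have hB := Finset.mem_powerset.1 hB
  rw [Finset.insert_union, hc _ _ (by simp [hxA, Finset.notMem_mono hB hxΛ]),
    Finset.prod_union (hA.mono_right hB), Finset.prod_neg (f := fun y => 1 + f x y),
    Finset.prod_const]
  ring

/-- A multiplicative family `c` with bounded insertion factors has non-negative
inclusion-exclusion sums. -/
theorem inclExcl_nonneg (hθ : 0 ≤ θ) (hρ : 0 ≤ ρ) (hf : ∀ x y, 0 ≤ 1 + f x y)
    (hc_nonneg : ∀ A, 0 ≤ c A)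
    (hc : ∀ (A : Finset X) (x : X), x ∉ A →
      c (insert x A) = ρ * (∏ y ∈ A, (1 + f x y)) * c A)
    (hκ : ∀ (A : Finset X) (x : X), 0 < c A → ρ * ∏ y ∈ A, (1 + f x y) ≤ κ)
    (hsmall : ∀ (Λ : Finset X) (x : X), x ∉ Λ →
      (1 + θ) * (κ * ∏ y ∈ Λ, (1 + θ * |f x y|)) ≤ θ)
    {A Λ : Finset X} (hA : Disjoint A Λ) : 0 ≤ inclExcl c A Λ := by
  -- The ratio bound for `|Λ| ≤ n` needs positivity up to `n` but itself only below `n`, since the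
  -- weights change one site at a time.
  have ratio_step : ∀ n : ℕ,
      (∀ A Λ : Finset X, Λ.card ≤ n → Disjoint A Λ → 0 ≤ inclExcl c A Λ) →
      (∀ (A Λ : Finset X) (x : X), Λ.card < n → Disjoint A Λ → x ∉ A → x ∉ Λ →
        (1 + θ) * inclExcl c (insert x A) Λ ≤ θ * inclExcl c A Λ) →
      ∀ (A Λ : Finset X) (x : X), Λ.card ≤ n → Disjoint A Λ → x ∉ A → x ∉ Λ →
        (1 + θ) * inclExcl c (insert x A) Λ ≤ θ * inclExcl c A Λ := by
    intro n h_nonneg h_ratio A Λ x hn hA hxA hxΛ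
    have hbd := abs_weightedSum_le (f := f x) hθ n h_nonneg h_ratio Λ A Λ hn hA subset_rfl
    rw [weightedSum_congr (h' := fun y => -(1 + f x y)) A (fun y hy => if_pos hy)] at hbd
    have hP := h_nonneg A Λ hn hA
    have hprod : 0 ≤ ∏ y ∈ Λ, (1 + θ * |f x y|) := Finset.prod_nonneg fun z _ => by positivity
    rcases (hc_nonneg A).eq_or_lt with h0 | hpos
    · have hzero : ∀ h, weightedSum c h A Λ = 0 := fun h =>
        Finset.sum_eq_zero fun B _ => by rw [apply_union_eq_zero hc h0.symm, mul_zero]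
      rw [inclExcl_insert_left hc hA hxA hxΛ, hzero]
      simpa using mul_nonneg hθ hP
    · rw [inclExcl_insert_left hc hA hxA hxΛ]
      have hr : 0 ≤ ρ * ∏ y ∈ A, (1 + f x y) :=
        mul_nonneg hρ (Finset.prod_nonneg fun y _ => hf x y)
      have h1 : ρ * (∏ y ∈ A, (1 + f x y)) * weightedSum c (fun y => -(1 + f x y)) A Λ ≤
          κ * (inclExcl c A Λ * ∏ y ∈ Λ, (1 + θ * |f x y|)) :=
        (mul_le_mul_of_nonneg_left ((le_abs_self _).trans hbd) hr).trans
          (mul_le_mul_of_nonneg_right (hκ A x hpos) (mul_nonneg hP hprod))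
      calc _ ≤ (1 + θ) * (κ * (inclExcl c A Λ * ∏ y ∈ Λ, (1 + θ * |f x y|))) :=
            mul_le_mul_of_nonneg_left h1 (by linarith)
        _ = (1 + θ) * (κ * ∏ y ∈ Λ, (1 + θ * |f x y|)) * inclExcl c A Λ := by ring
        _ ≤ _ := mul_le_mul_of_nonneg_right (hsmall Λ x hxΛ) hP
  have main : ∀ n : ℕ,
      (∀ A Λ : Finset X, Λ.card ≤ n → Disjoint A Λ → 0 ≤ inclExcl c A Λ) ∧
      (∀ (A Λ : Finset X) (x : X), Λ.card ≤ n → Disjoint A Λ → x ∉ A → x ∉ Λ →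
        (1 + θ) * inclExcl c (insert x A) Λ ≤ θ * inclExcl c A Λ) := by
    intro n
    induction n with
    | zero =>
      have h0 : ∀ A Λ : Finset X, Λ.card ≤ 0 → Disjoint A Λ → 0 ≤ inclExcl c A Λ := by
        intro A Λ hΛ _
        obtain rfl : Λ = ∅ := Finset.card_eq_zero.1 (Nat.le_zero.1 hΛ)
        simpa using hc_nonneg A
      exact ⟨h0, ratio_step 0 h0 fun _ _ _ h => absurd h (Nat.not_lt_zero _)⟩
    | succ n ih =>
      have h1 : ∀ A Λ : Finset X, Λ.card ≤ n + 1 → Disjoint A Λ → 0 ≤ inclExcl c A Λ := by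
        intro A Λ hΛ hA
        rcases Λ.eq_empty_or_nonempty with rfl | ⟨y, hy⟩
        · simpa using hc_nonneg A
        · obtain ⟨Λ, hyΛ, rfl⟩ : ∃ Λ', y ∉ Λ' ∧ insert y Λ' = Λ :=
            ⟨Λ.erase y, Finset.notMem_erase _ _, Finset.insert_erase hy⟩
          rw [Finset.card_insert_of_notMem hyΛ] at hΛ
          obtain ⟨hyA, hA'⟩ := Finset.disjoint_insert_right.1 hA
          have h2 := ih.1 A Λ (by omega) hA'
          have h3 := ih.2 A Λ y (by omega) hA' hyA hyΛ
          rw [inclExcl_insert _ hyΛ]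
          -- The ratio `θ/(1+θ)` is at most `1`, so the difference is non-negative.
          nlinarith
      exact ⟨h1, ratio_step _ h1 fun A Λ x h => ih.2 A Λ x (by omega)⟩
  exact (main Λ.card).1 A Λ le_rfl hA

end Positivity

/-! ### Point processes from occupation probabilities. -/

section Measures

variable {X : Type*}

/-- The event that all sites of `A` are occupied. -/
def occupiedOn (A : Finset X) : Set (LatticeConfig X) := {η | ∀ x ∈ A, η x = true}

lemma occupiedOn_eq_iInter (A : Finset X) :
    occupiedOn A = ⋂ x ∈ A, (fun η : LatticeConfig X => η x) ⁻¹' {true} := by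
  ext η; simp [occupiedOn]

lemma measurableSet_occupiedOn (A : Finset X) : MeasurableSet (occupiedOn A) := by
  rw [occupiedOn_eq_iInter]
  exact A.measurableSet_biInter fun x _ => measurable_pi_apply x (measurableSet_singleton _)

lemma isClopen_occupiedOn (A : Finset X) : IsClopen (occupiedOn A) := by
  rw [occupiedOn_eq_iInter]
  exact A.finite_toSet.isClopen_biInter fun x _ =>
    (isClopen_discrete {true}).preimage (continuous_apply x)

lemma isPiSystem_occupiedOn : IsPiSystem (Set.range (occupiedOn (X := X))) := by
  classical
  rintro _ ⟨A, rfl⟩ _ ⟨B, rfl⟩ _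
  refine ⟨A ∪ B, ?_⟩
  ext η
  simp only [occupiedOn, Finset.mem_union, Set.mem_inter_iff, Set.mem_ofPred_eq]
  exact ⟨fun h => ⟨fun x hx => h x (Or.inl hx), fun x hx => h x (Or.inr hx)⟩,
    fun h x hx => hx.elim (h.1 x) (h.2 x)⟩

lemma generateFrom_occupiedOn :
    (MeasurableSpace.pi : MeasurableSpace (LatticeConfig X)) =
      MeasurableSpace.generateFrom (Set.range occupiedOn) := by
  apply le_antisymm
  · refine iSup_le fun x => ?_
    rw [← measurable_iff_comap_le]
    refine @measurable_to_bool _ (MeasurableSpace.generateFrom _) _ ?_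
    refine MeasurableSpace.measurableSet_generateFrom ⟨{x}, ?_⟩
    ext η; simp [occupiedOn]
  · refine MeasurableSpace.generateFrom_le ?_
    rintro _ ⟨A, rfl⟩
    exact measurableSet_occupiedOn A

/-- A law of configurations is determined by the probabilities that finitely many sites are
occupied. -/
lemma ext_of_occupiedOn {μ ν : Measure (LatticeConfig X)} [IsFiniteMeasure μ]
    (h : ∀ A, μ (occupiedOn A) = ν (occupiedOn A)) : μ = ν := by
  refine ext_of_generate_finite _ generateFrom_occupiedOn isPiSystem_occupiedOn ?_ ?_
  · rintro _ ⟨A, rfl⟩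
    exact h A
  · have : occupiedOn (∅ : Finset X) = Set.univ := by ext η; simp [occupiedOn]
    rw [← this]
    exact h ∅

lemma corr₁_eq (μ : Measure (LatticeConfig X)) (x : X) :
    corr₁ μ x = μ.real (occupiedOn {x}) := by
  have : (fun η : LatticeConfig X => empiricalField η x) =
      (occupiedOn {x}).indicator 1 := by
    ext η; simp [empiricalField, occupiedOn, Set.indicator]
  rw [corr₁, this, integral_indicator_one (measurableSet_occupiedOn _)]

variable [DecidableEq X]

/-- The law on configurations supported in `Λ` with occupation probabilities `c`. -/
noncomputable def finiteVolumeMeasure (c : Finset X → ℝ) (Λ : Finset X) : Measure (LatticeConfig X) :=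
  ∑ B ∈ Λ.powerset, ENNReal.ofReal (inclExcl c B (Λ \ B)) •
    Measure.dirac (fun x => decide (x ∈ B))

lemma finiteVolumeMeasure_occupiedOn {c : Finset X → ℝ}
    (hc : ∀ A Λ : Finset X, Disjoint A Λ → 0 ≤ inclExcl c A Λ) {S Λ : Finset X} (hS : S ⊆ Λ) :
    finiteVolumeMeasure c Λ (occupiedOn S) = ENNReal.ofReal (c S) := by
  have hmem : ∀ B : Finset X, (fun x => decide (x ∈ B)) ∈ occupiedOn S ↔ S ⊆ B := fun B => by
    simp [occupiedOn, Finset.subset_iff]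
  simp only [finiteVolumeMeasure, Measure.coe_finsetSum, Finset.sum_apply, Measure.smul_apply,
    smul_eq_mul, Measure.dirac_apply' _ (measurableSet_occupiedOn S), Set.indicator, hmem,
    Pi.one_apply, mul_ite, mul_one, mul_zero]
  rw [← Finset.sum_filter, ← ENNReal.ofReal_sum_of_nonneg fun B _ =>
    hc _ _ Finset.disjoint_sdiff, ← sum_inclExcl_sdiff (c := c) S (Λ \ S)]
  congr 1
  symm
  -- Sets between `S` and `Λ` correspond to subsets of `Λ \ S`.
  refine Finset.sum_bij' (fun B _ => S ∪ B) (fun B _ => B \ S) ?_ ?_ ?_ ?_ ?_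
  · intro B hB
    have := Finset.mem_powerset.1 hB
    simp only [Finset.mem_filter, Finset.mem_powerset]
    exact ⟨Finset.union_subset hS (this.trans Finset.sdiff_subset), Finset.subset_union_left⟩
  · intro B hB
    simp only [Finset.mem_filter, Finset.mem_powerset] at hB ⊢
    exact Finset.sdiff_subset_sdiff hB.1 subset_rfl
  · intro B hB
    have := Finset.mem_powerset.1 hB
    exact Finset.union_sdiff_cancel_left (Finset.disjoint_sdiff.mono_right this)
  · intro B hB
    simp only [Finset.mem_filter, Finset.mem_powerset] at hB
    exact Finset.union_sdiff_of_subset hB.2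
  · intro B _
    rw [sdiff_sdiff]; rfl

/-- A family with `c ∅ = 1` and non-negative inclusion-exclusion sums consists of the occupation
probabilities of a point process. -/
theorem exists_measure_occupiedOn [Countable X] {c : Finset X → ℝ} (hc_empty : c ∅ = 1)
    (hc : ∀ A Λ : Finset X, Disjoint A Λ → 0 ≤ inclExcl c A Λ) :
    ∃ μ : Measure (LatticeConfig X), IsProbabilityMeasure μ ∧
      ∀ A, μ (occupiedOn A) = ENNReal.ofReal (c A) := by
  have hprob : ∀ Λ, IsProbabilityMeasure (finiteVolumeMeasure c Λ) := fun Λ => ⟨by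
    have h := finiteVolumeMeasure_occupiedOn hc (Finset.empty_subset Λ)
    have hu : occupiedOn (∅ : Finset X) = Set.univ := by ext η; simp [occupiedOn]
    rw [← hu, h, hc_empty, ENNReal.ofReal_one]⟩
  let ν : Finset X → ProbabilityMeasure (LatticeConfig X) := fun Λ =>
    ⟨finiteVolumeMeasure c Λ, hprob Λ⟩
  -- Weak limit along an ultrafilter of growing volumes. Occupation events are clopen, so their
  -- probabilities pass to the limit; they are eventually constant.
  obtain ⟨μ, -, hμ⟩ := isCompact_univ.ultrafilter_le_nhds
    ((Ultrafilter.of Filter.atTop).map ν) (by simp)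
  have hlim : Filter.Tendsto ν (↑(Ultrafilter.of (Filter.atTop : Filter (Finset X)))) (nhds μ) := hμ
  refine ⟨μ, inferInstance, fun A => ?_⟩
  have h1 := ProbabilityMeasure.tendsto_measure_of_null_frontier_of_tendsto' hlim
    (E := occupiedOn A) (by rw [(isClopen_occupiedOn A).frontier_eq, measure_empty])
  refine tendsto_nhds_unique h1 (tendsto_const_nhds.congr' ?_)
  refine Ultrafilter.of_le _ ?_
  filter_upwards [Filter.eventually_ge_atTop A] with Λ hΛ
  exact (finiteVolumeMeasure_occupiedOn hc hΛ).symm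

lemma isTranslationInvariant_of_occupiedOn {X : Type*} [AddGroup X]
    {μ : Measure (LatticeConfig X)} [IsFiniteMeasure μ]
    (h : ∀ (A : Finset X) (a : X), μ (occupiedOn (A.map (addRightEmbedding a))) =
      μ (occupiedOn A)) : IsTranslationInvariant μ := by
  intro a
  have hmeas : Measurable (fun (η : LatticeConfig X) (x : X) => η (x + a)) :=
    measurable_pi_lambda _ fun x => measurable_pi_apply _
  refine ⟨hmeas, ext_of_occupiedOn fun A => ?_⟩
  rw [Measure.map_apply hmeas (measurableSet_occupiedOn A), ← h A a]
  congr 1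
  ext η
  simp [occupiedOn]

lemma integral_empiricalField_mul (μ : Measure (LatticeConfig X)) (x y : X) :
    ∫ η, empiricalField η x * empiricalField η y ∂μ = μ.real (occupiedOn {x, y}) := by
  have : (fun η : LatticeConfig X => empiricalField η x * empiricalField η y) =
      (occupiedOn {x, y}).indicator 1 := by
    ext η
    by_cases hx : η x = true <;> by_cases hy : η y = true <;>
      simp [empiricalField, occupiedOn, Set.indicator, hx, hy]
  rw [this, integral_indicator_one (measurableSet_occupiedOn _)]

end Measures

/-! ### The product-form correlations. -/

section PairProduct

variable {X : Type*} [AddCommGroup X] {g : X → ℝ}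

/-- The candidate occupation probabilities `ρ^|A| ∏_{x, y} g(x - y)`, with the product over the
unordered pairs of distinct points of `A`. -/
noncomputable def pairCorrelation (ρ : ℝ) (g : X → ℝ) (A : Finset X) : ℝ :=
  ρ ^ A.card * ∏ p ∈ A.offDiag, √(g (p.1 - p.2))

@[simp] lemma pairCorrelation_empty (ρ : ℝ) (g : X → ℝ) : pairCorrelation ρ g ∅ = 1 := by
  simp [pairCorrelation]

lemma pairCorrelation_nonneg {ρ : ℝ} (hρ : 0 ≤ ρ) (A : Finset X) : 0 ≤ pairCorrelation ρ g A :=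
  mul_nonneg (pow_nonneg hρ _) (Finset.prod_nonneg fun _ _ => Real.sqrt_nonneg _)

/-- `offDiag` lists each pair in both orders; as `g` is even, the two square roots multiply to `g`.
-/
lemma pairCorrelation_insert [DecidableEq X] (heven : Function.Even g) (hg : ∀ x, 0 ≤ g x) (ρ : ℝ)
    {A : Finset X} {x : X} (hx : x ∉ A) :
    pairCorrelation ρ g (insert x A) =
      ρ * (∏ y ∈ A, g (x - y)) * pairCorrelation ρ g A := by
  have h1 : Disjoint (A.offDiag ∪ {x} ×ˢ A) (A ×ˢ {x}) := by
    rw [Finset.disjoint_left]; rintro ⟨y, z⟩ h h'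
    simp at h h'; grind
  have h2 : Disjoint A.offDiag ({x} ×ˢ A) := by
    rw [Finset.disjoint_left]; rintro ⟨y, z⟩ h h'
    simp at h h'; grind
  have h3 : ∏ y ∈ A, g (x - y) = (∏ y ∈ A, √(g (x - y))) * ∏ y ∈ A, √(g (y - x)) := by
    rw [← Finset.prod_mul_distrib]
    refine Finset.prod_congr rfl fun y _ => ?_
    rw [← heven (y - x), neg_sub, Real.mul_self_sqrt (hg _)]
  rw [pairCorrelation, pairCorrelation, Finset.card_insert_of_notMem hx, Finset.offDiag_insert hx,
    Finset.prod_union h1, Finset.prod_union h2, Finset.prod_product, Finset.prod_product, h3]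
  simp only [Finset.prod_singleton]
  ring

lemma pairCorrelation_map_addRight (ρ : ℝ) (g : X → ℝ) (A : Finset X) (a : X) :
    pairCorrelation ρ g (A.map (addRightEmbedding a)) = pairCorrelation ρ g A := by
  rw [pairCorrelation, pairCorrelation, Finset.card_map]
  congr 1
  have : (A.map (addRightEmbedding a)).offDiag =
      A.offDiag.map ((addRightEmbedding a).prodMap (addRightEmbedding a)) := by
    ext ⟨y, z⟩
    simp only [Finset.mem_offDiag, Finset.mem_map, addRightEmbedding_apply, Prod.exists,
      Function.Embedding.coe_prodMap, Prod.map_apply, Prod.mk.injEq]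
    constructor
    · rintro ⟨⟨u, hu, rfl⟩, ⟨v, hv, rfl⟩, hne⟩
      exact ⟨u, v, ⟨hu, hv, fun h => hne (h ▸ rfl)⟩, rfl, rfl⟩
    · rintro ⟨u, v, ⟨hu, hv, hne⟩, rfl, rfl⟩
      exact ⟨⟨u, hu, rfl⟩, ⟨v, hv, rfl⟩, fun h => hne (add_right_cancel h)⟩
  rw [this, Finset.prod_map]
  simp

/-- Stability is applied to the points `x - y`, `y ∈ A`, whose differences are those of `A`;
positivity of the correlation makes `g` positive on them. -/
lemma IsStabilityConstant.prod_le {b ρ : ℝ} (hstab : IsStabilityConstant g b) (hb : 1 ≤ b)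
    {A : Finset X} (hA : 0 < pairCorrelation ρ g A)
    (x : X) : ∏ y ∈ A, g (x - y) ≤ b := by
  rcases A.eq_empty_or_nonempty with rfl | hne
  · simpa using hb
  let e := A.equivFin.symm
  have hpair : ∀ y ∈ A, ∀ z ∈ A, y ≠ z → 0 < g (y - z) := fun y hy z hz hyz => by
    have h := (Finset.prod_ne_zero_iff.1 (right_ne_zero_of_mul hA.ne')) (y, z)
      (Finset.mem_offDiag.2 ⟨hy, hz, hyz⟩)
    exact Real.sqrt_pos.1 (lt_of_le_of_ne (Real.sqrt_nonneg _) h.symm)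
  have h := hstab A.card hne.card_pos (fun i => x - e i) <| by
    refine Finset.prod_pos fun i _ => Finset.prod_pos fun j hj => ?_
    have hij : e j ≠ e i := fun h => (Finset.mem_Ioi.1 hj).ne' (e.injective h)
    rw [sub_sub_sub_cancel_left]
    exact hpair _ (e j).2 _ (e i).2 fun h => hij (Subtype.ext h)
  rwa [e.prod_comp (fun y : A => g (x - y)), Finset.prod_coe_sort A fun y => g (x - y)] at h

end PairProduct

/-! ### The density threshold. -/

section Smallness

variable {X : Type*} [AddCommGroup X] {g : X → ℝ}

/-- The extra `1` is the term `|g 0 - 1|`, contributed by the site `x` itself. -/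
lemma one_add_sum_le_absDeviation (hg_zero : g 0 = 0)
    (hg_sum : Summable fun x => |g x - 1|) {Λ : Finset X} {x : X} (hx : x ∉ Λ) :
    1 + ∑ y ∈ Λ, |g (x - y) - 1| ≤ absDeviation g := by
  classical
  have h := (hg_sum.comp_injective (sub_right_injective (b := x))).sum_le_tsum (insert x Λ)
    fun _ _ => abs_nonneg _
  have ht : ∑' y, ((fun z => |g z - 1|) ∘ fun y => x - y) y = absDeviation g :=
    (Equiv.subLeft x).tsum_eq fun z => |g z - 1|
  rw [ht, Finset.sum_insert hx] at h
  simpa [hg_zero] using h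

/-- The factors are bounded by `exp θ` and `exp (1 - θ)`, whose product is exactly `e`; the saved
`θ` comes from the origin term of `C(g)`. -/
lemma insertion_bound (hg_zero : g 0 = 0) (hg_sum : Summable fun x => |g x - 1|)
    {b ρ : ℝ} (hb : 1 ≤ b) (hρ : 0 ≤ ρ)
    (hρ_le : ρ ≤ (Real.exp 1 * b * absDeviation g)⁻¹) {Λ : Finset X} {x : X} (hx : x ∉ Λ) :
    (1 + (absDeviation g)⁻¹) *
      (ρ * b * ∏ y ∈ Λ, (1 + (absDeviation g)⁻¹ * |g (x - y) - 1|)) ≤ (absDeviation g)⁻¹ := by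
  have hC := one_add_sum_le_absDeviation hg_zero hg_sum hx
  set C := absDeviation g
  have hC1 : 1 ≤ C := le_trans (by simpa using Finset.sum_nonneg fun y _ => abs_nonneg _) hC
  have hC0 : 0 < C := by linarith
  have hθ : 0 < C⁻¹ := inv_pos.2 hC0
  have h1 : ∏ y ∈ Λ, (1 + C⁻¹ * |g (x - y) - 1|) ≤ Real.exp (1 - C⁻¹) := by
    calc _ ≤ ∏ y ∈ Λ, Real.exp (C⁻¹ * |g (x - y) - 1|) :=
          Finset.prod_le_prod (fun y _ => by positivity) fun y _ => by
            rw [add_comm]; exact Real.add_one_le_exp _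
      _ = Real.exp (C⁻¹ * ∑ y ∈ Λ, |g (x - y) - 1|) := by rw [← Real.exp_sum, Finset.mul_sum]
      _ ≤ _ := by
        refine Real.exp_le_exp.2 ?_
        calc _ ≤ C⁻¹ * (C - 1) := mul_le_mul_of_nonneg_left (by linarith) hθ.le
          _ = _ := by field_simp
  have h2 : 1 + C⁻¹ ≤ Real.exp C⁻¹ := by rw [add_comm]; exact Real.add_one_le_exp _
  have hρb : 0 ≤ ρ * b := mul_nonneg hρ (by linarith)
  calc _ ≤ Real.exp C⁻¹ * (ρ * b * Real.exp (1 - C⁻¹)) := by gcongr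
    _ = ρ * (Real.exp 1 * b) := by
      rw [Real.exp_sub]; field_simp
    _ ≤ (Real.exp 1 * b * C)⁻¹ * (Real.exp 1 * b) := by gcongr
    _ = C⁻¹ := by field_simp

end Smallness

/-! ### Realizability. -/

theorem mainTheorem4 (d : ℕ) (g : (Fin d → ℤ) → ℝ)
    (hg_even : Function.Even g) (hg_nonneg : ∀ x, 0 ≤ g x) (hg_zero : g 0 = 0)
    (hg_sum : Summable fun x => |g x - 1|)
    (b : ℝ) (hb : 1 ≤ b) (hg_stab : IsStabilityConstant g b)
    (ρ : ℝ) (hρ_nonneg : 0 ≤ ρ) (hρ_le : ρ ≤ (Real.exp 1 * b * absDeviation g)⁻¹) :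
    IsRealizable ρ g := by
  have hins : ∀ (A : Finset (Fin d → ℤ)) (x : Fin d → ℤ), x ∉ A →
      pairCorrelation ρ g (insert x A) =
        ρ * (∏ y ∈ A, (1 + (g (x - y) - 1))) * pairCorrelation ρ g A := fun A x hx => by
    simpa using pairCorrelation_insert hg_even hg_nonneg ρ hx
  have hpos : ∀ A Λ : Finset (Fin d → ℤ), Disjoint A Λ →
      0 ≤ inclExcl (pairCorrelation ρ g) A Λ := fun A Λ hA =>
    inclExcl_nonneg (f := fun x y => g (x - y) - 1) (ρ := ρ) (κ := ρ * b)
      (θ := (absDeviation g)⁻¹) (inv_nonneg.2 (tsum_nonneg fun _ => abs_nonneg _)) hρ_nonneg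
      (fun x y => by simpa using hg_nonneg (x - y)) (pairCorrelation_nonneg hρ_nonneg) hins
      (fun A x hA => by
        simpa using mul_le_mul_of_nonneg_left (hg_stab.prod_le hb hA x) hρ_nonneg)
      (fun Λ x hx => insertion_bound hg_zero hg_sum hb hρ_nonneg hρ_le hx) hA
  obtain ⟨μ, hμ, hμc⟩ := exists_measure_occupiedOn (pairCorrelation_empty ρ g) hpos
  have hreal : ∀ A, μ.real (occupiedOn A) = pairCorrelation ρ g A := fun A => by
    rw [measureReal_def, hμc, ENNReal.toReal_ofReal (pairCorrelation_nonneg hρ_nonneg A)]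
  have hone : ∀ x, corr₁ μ x = ρ := fun x => by
    rw [corr₁_eq, hreal]; simp [pairCorrelation]
  refine ⟨μ, hμ, isTranslationInvariant_of_occupiedOn fun A a => ?_, hone, fun x y => ?_⟩
  · rw [hμc, hμc, pairCorrelation_map_addRight]
  · rw [corr₂, integral_empiricalField_mul, hreal, hone]
    -- On the diagonal both sides vanish: `η(x)² = η(x)` and `g 0 = 0`.
    by_cases hxy : x = y
    · subst hxy
      simp [pairCorrelation, hg_zero]
    · rw [hins {y} x (by simpa using hxy), ← hg_even (y - x)]
      simp [hxy, pairCorrelation]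
      ring
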